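/- Theorem. Let $L>0$ and let $T=\mathbb{R}^2/(L\mathbb{Z})^2$ be the square torus of side $L$, with its flat metric and area. For an integer $n\ge 0$ and a real $r>0$, a packing of $n$ equal disks of radius $r$ in $T$ consists of $n$ points $c_1,\dots,c_n\in T$ such that the open disks of radius $r$ about the $c_i$ are pairwise disjoint and no disk overlaps itself around the torus, i.e. for every $i$ the projection $\mathbb{R}^2\to T$ is injective on each open planar disk of radius $r$ whose center lies over $c_i$. Its density $\delta$ is the area of the union of the disks divided by the area $L^2$ of $T$. Then every such packing satisfies $$\delta<\frac{\pi}{\sqrt{12}}.$$ -/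

import Mathlib

open MeasureTheory

noncomputable section

/-- The Euclidean plane. -/
abbrev Plane : Type := EuclideanSpace ℝ (Fin 2)

/-- The square lattice `Lℤ × Lℤ` in the plane. -/
def squareLattice (L : ℝ) : AddSubgroup Plane where
  carrier := {v | ∀ i, ∃ k : ℤ, v i = k * L}
  zero_mem' := fun _ => ⟨0, by simp⟩
  add_mem' := by
    intro v w hv hw i
    obtain ⟨k, hk⟩ := hv i
    obtain ⟨l, hl⟩ := hw i
    exact ⟨k + l, by simp [hk, hl, add_mul]⟩
  neg_mem' := by
    intro v hv i
    obtain ⟨k, hk⟩ := hv i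
    exact ⟨-k, by simp [hk]⟩

/-- The square torus of side `L`: the plane modulo the square lattice. Its metric is the quotient
metric `dist [x] [y] = inf {‖x - y + v‖ : v ∈ squareLattice L}`, i.e. the flat metric. -/
abbrev SquareTorus (L : ℝ) : Type := Plane ⧸ squareLattice L

namespace SquareTorus

/-- The projection from the plane to the square torus. -/
def proj (L : ℝ) (x : Plane) : SquareTorus L := QuotientAddGroup.mk x

/-- The half-open square `[0, L)²`, a fundamental domain of the square lattice. -/
def fundamentalSquare (L : ℝ) : Set Plane := {x | ∀ i, x i ∈ Set.Ico 0 L}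

/-- The area measure of the square torus: `area L A` is the Lebesgue measure of the part of the
fundamental square that lies over `A`. -/
def area (L : ℝ) : Measure (SquareTorus L) :=
  (volume.restrict (fundamentalSquare L)).map (proj L)

end SquareTorus

open SquareTorus in
/-- A packing of `n` equal disks in the square torus of side `L`. The disks are represented by
their interiors, so that they may touch each other, or themselves around the torus. -/
structure DiskPacking (L : ℝ) (n : ℕ) where
  /-- The centers of the disks. -/
  center : Fin n → SquareTorus L
  /-- The common radius. -/
  radius : ℝ
  radius_pos : 0 < radius
  /-- Each disk is a genuine disk: the projection maps the interior of a planar disk lying over it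
  injectively, so the disk does not overlap itself around the torus. -/
  embedded : ∀ x : Plane, ∀ i, proj L x = center i →
    Set.InjOn (proj L) (Metric.ball x radius)
  /-- Different disks have disjoint interiors. -/
  disjoint : ∀ i j, i ≠ j →
    Disjoint (Metric.ball (center i) radius) (Metric.ball (center j) radius)

/-- The density of a packing: the fraction of the area of the torus covered by the disks. -/
def DiskPacking.density {L : ℝ} {n : ℕ} (P : DiskPacking L n) : ℝ :=
  (SquareTorus.area L).real (⋃ i, Metric.ball (P.center i) P.radius) / (SquareTorus.area L).real Set.univ

end

/-! Let r be the common radius and R = 2r/√3, the circumradius of the regular hexagon circumscribed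
about a disk of radius r. The lifts of the centers to the plane are pairwise at distance at least 2r
= √3 R. Around each lift take the part of the disk of radius R lying in its Voronoi cell. These
truncated cells are disjoint, and modulo the lattice they fit into area L².

Each truncated cell has at least the area (3√3/2)R² = 2√3 r² of the hexagon. It is the disk minus
the circular segments cut off by the neighbors a with ‖a‖ < 2R. Such a segment lies in the sector of
half-angle α = arccos(‖a‖/2R) ≤ π/6, and concavity of sine on [0, π/3] makes it at most the fraction
1 - 3√3/(2π) of that sector (`volume_real_circularSegment_le`). The sectors are disjoint
(`disjoint_circularSector`), so the segments together take at most that fraction of πR². Hence n ·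
2√3 r² ≤ L², which gives density at most π/√12.

In case of equality every cell is minimal: all neighbors are at distance exactly √3 R and the
sectors leave no gap, so the neighbors are permuted by rotation through 60°
(`hexagonal_of_volume_real_truncatedCell_le`). Stepping along a neighbor vector a then never leaves
the set of lifts. As there are finitely many centers, positive multiples of a and of its rotation by
60° are in the square lattice, which would make √3 rational (`not_commensurable_hexagonal_square`).
-/

open scoped Pointwise

/-! ### Areas of circular sectors and segments -/

/-- The open sector of the disk of radius `R` about `0` whose arc is the part of the circle lying
closer to `a` than to `0`. -/
def circularSector (R : ℝ) (a : ℂ) : Set ℂ :=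
  {z | ‖z‖ < R ∧ ‖z‖ * ‖a‖ ^ 2 < 2 * R * inner ℝ z a}

/-- The segment of the open disk of radius `R` about `0` of points not farther from `a` than
from `0`. -/
def circularSegment (R : ℝ) (a : ℂ) : Set ℂ :=
  {z | ‖z‖ < R ∧ ‖a‖ ^ 2 ≤ 2 * inner ℝ z a}

lemma Complex.inner_eq_re_im (z w : ℂ) : inner ℝ z w = z.re * w.re + z.im * w.im := by
  simp [Complex.inner]; ring

lemma Complex.norm_sq_eq_re_im (z : ℂ) : ‖z‖ ^ 2 = z.re ^ 2 + z.im ^ 2 := by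
  rw [Complex.sq_norm, Complex.normSq_apply]; ring

lemma isOpen_circularSector (R : ℝ) (a : ℂ) : IsOpen (circularSector R a) := by
  refine IsOpen.and (isOpen_lt ?_ ?_) (isOpen_lt ?_ ?_) <;> fun_prop

lemma measurableSet_circularSegment (R : ℝ) (a : ℂ) : MeasurableSet (circularSegment R a) := by
  have h₁ : IsOpen {z : ℂ | ‖z‖ < R} := isOpen_lt (by fun_prop) (by fun_prop)
  have h₂ : IsClosed {z : ℂ | ‖a‖ ^ 2 ≤ 2 * inner ℝ z a} := isClosed_le (by fun_prop) (by fun_prop)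
  exact h₁.measurableSet.inter h₂.measurableSet

lemma circularSector_subset_ball (R : ℝ) (a : ℂ) : circularSector R a ⊆ Metric.ball 0 R :=
  fun z hz => by simpa using hz.1

lemma circularSegment_subset_ball (R : ℝ) (a : ℂ) : circularSegment R a ⊆ Metric.ball 0 R :=
  fun z hz => by simpa using hz.1

lemma mem_circularSector_ofReal {R h : ℝ} (hh : 0 < h) {z : ℂ} :
    z ∈ circularSector R ((2 * h : ℝ) : ℂ) ↔ ‖z‖ < R ∧ ‖z‖ * h < R * z.re := by
  unfold circularSector
  rw [Set.mem_ofPred_eq, Complex.inner_eq_re_im, Complex.norm_real, Complex.ofReal_re,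
    Complex.ofReal_im, Real.norm_eq_abs, sq_abs]
  refine and_congr_right fun _ => ?_
  constructor
  · intro H; nlinarith
  · intro H; nlinarith

lemma mem_circularSegment_ofReal {R h : ℝ} (hh : 0 < h) {z : ℂ} :
    z ∈ circularSegment R ((2 * h : ℝ) : ℂ) ↔ ‖z‖ < R ∧ h ≤ z.re := by
  unfold circularSegment
  rw [Set.mem_ofPred_eq, Complex.inner_eq_re_im, Complex.norm_real, Complex.ofReal_re,
    Complex.ofReal_im, Real.norm_eq_abs, sq_abs]
  refine and_congr_right fun _ => ?_
  constructor
  · intro H; nlinarith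
  · intro H; nlinarith

lemma volume_real_circularSector_ofReal {R h : ℝ} (hh : 0 < h) (hR : h ≤ R) :
    volume.real (circularSector R ((2 * h : ℝ) : ℂ)) = R ^ 2 * Real.arccos (h / R) := by
  have hR0 : 0 < R := hh.trans_le hR
  set α := Real.arccos (h / R) with hα
  have hα0 : 0 ≤ α := Real.arccos_nonneg _
  have hαπ : α < Real.pi := by
    have := Real.arccos_lt_pi_div_two.2 (div_pos hh hR0)
    linarith [Real.pi_pos]
  have hcos : Real.cos α = h / R :=
    Real.cos_arccos (by linarith [div_pos hh hR0]) ((div_le_one hR0).2 hR)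
  have hS : MeasurableSet (circularSector R ((2 * h : ℝ) : ℂ)) :=
    (isOpen_circularSector _ _).measurableSet
  have key : ∀ p ∈ polarCoord.target,
      p.1 • (circularSector R ((2 * h : ℝ) : ℂ)).indicator (fun _ => (1 : ℝ))
        (Complex.polarCoord.symm p)
      = (Set.Ioo 0 R ×ˢ Set.Ioo (-α) α).indicator (fun p : ℝ × ℝ => p.1 * 1) p := by
    intro p hp
    obtain ⟨hp1, hp2⟩ : 0 < p.1 ∧ (-Real.pi < p.2 ∧ p.2 < Real.pi) := by
      simpa [polarCoord_target] using hp
    have hmem : Complex.polarCoord.symm p ∈ circularSector R ((2 * h : ℝ) : ℂ) ↔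
        p ∈ Set.Ioo 0 R ×ˢ Set.Ioo (-α) α := by
      rw [mem_circularSector_ofReal hh, Complex.norm_polarCoord_symm, abs_of_pos hp1]
      have hre : (Complex.polarCoord.symm p).re = p.1 * Real.cos p.2 := by
        simp [-Complex.ofReal_cos, -Complex.ofReal_sin]
      rw [hre, Set.mem_prod, Set.mem_Ioo, Set.mem_Ioo, ← abs_lt]
      have : p.1 * h < R * (p.1 * Real.cos p.2) ↔ Real.cos α < Real.cos |p.2| := by
        rw [hcos, Real.cos_abs, div_lt_iff₀ hR0, show R * (p.1 * Real.cos p.2) =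
          p.1 * (Real.cos p.2 * R) by ring, mul_lt_mul_iff_right₀ hp1]
      rw [this, Real.strictAntiOn_cos.lt_iff_gt ⟨hα0, hαπ.le⟩
        ⟨abs_nonneg _, (abs_lt.2 hp2).le⟩]
      tauto
    by_cases hm : p ∈ Set.Ioo 0 R ×ˢ Set.Ioo (-α) α
    · rw [Set.indicator_of_mem hm, Set.indicator_of_mem (hmem.2 hm)]; simp
    · rw [Set.indicator_of_notMem hm, Set.indicator_of_notMem (fun h => hm (hmem.1 h))]; simp
  have h1 : volume.real (circularSector R ((2 * h : ℝ) : ℂ)) =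
      ∫ z, (circularSector R ((2 * h : ℝ) : ℂ)).indicator (fun _ => (1 : ℝ)) z := by
    rw [integral_indicator_const _ hS]; simp
  have hsub : Set.Ioo 0 R ×ˢ Set.Ioo (-α) α ⊆ polarCoord.target := by
    rw [polarCoord_target]
    exact Set.prod_mono (fun x hx => hx.1) (Set.Ioo_subset_Ioo (by linarith) hαπ.le)
  rw [h1, ← Complex.integral_comp_polarCoord_symm,
    setIntegral_congr_fun polarCoord.open_target.measurableSet key,
    setIntegral_indicator (measurableSet_Ioo.prod measurableSet_Ioo),
    Set.inter_eq_self_of_subset_right hsub, Measure.volume_eq_prod,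
    setIntegral_prod_mul (fun x : ℝ => x) (fun _ : ℝ => (1 : ℝ)),
    ← integral_Ioc_eq_integral_Ioo, ← intervalIntegral.integral_of_le hR0.le, integral_id]
  simp [hα0]
  ring

lemma volume_real_triangle {R h : ℝ} (hh : 0 < h) (hR : h ≤ R) :
    volume.real {z : ℂ | z.re < h ∧ ‖z‖ * h < R * z.re} = h * √(R ^ 2 - h ^ 2) := by
  have hR0 : 0 < R := hh.trans_le hR
  set s := √(R ^ 2 - h ^ 2) with hs
  have hs0 : 0 ≤ s := Real.sqrt_nonneg _
  have hs2 : s ^ 2 = R ^ 2 - h ^ 2 := Real.sq_sqrt (by nlinarith)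
  have hset : {z : ℂ | z.re < h ∧ ‖z‖ * h < R * z.re} = Complex.measurableEquivRealProd ⁻¹'
      (regionBetween (fun x => -(s / h * x)) (fun x => s / h * x) (Set.Ioo 0 h)) := by
    ext z
    have hz := Complex.norm_sq_eq_re_im z
    simp only [regionBetween, Set.mem_preimage, Set.mem_ofPred_eq,
      Complex.measurableEquivRealProd_apply, Set.mem_Ioo, ← abs_lt]
    have e1 : |z.im| < s / h * z.re ↔ |z.im| * h < s * z.re := by
      rw [div_mul_eq_mul_div, lt_div_iff₀ hh]
    rw [e1]
    constructor
    · rintro ⟨h1, h2⟩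
      have hre : 0 < z.re := by
        by_contra hc
        have : R * z.re ≤ 0 := mul_nonpos_of_nonneg_of_nonpos hR0.le (not_lt.1 hc)
        linarith [mul_nonneg (norm_nonneg z) hh.le]
      refine ⟨⟨hre, h1⟩, ?_⟩
      have h3 := pow_lt_pow_left₀ h2 (by positivity) two_ne_zero
      refine lt_of_pow_lt_pow_left₀ 2 (by positivity) ?_
      rw [mul_pow, mul_pow] at h3 ⊢
      rw [sq_abs, hs2]
      rw [hz] at h3
      nlinarith
    · rintro ⟨⟨hre, h1⟩, h2⟩
      refine ⟨h1, ?_⟩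
      have h3 := pow_lt_pow_left₀ h2 (by positivity) two_ne_zero
      refine lt_of_pow_lt_pow_left₀ 2 (by positivity) ?_
      rw [mul_pow, mul_pow] at h3 ⊢
      rw [sq_abs, hs2] at h3
      rw [hz]
      nlinarith
  have hcont : Continuous fun x : ℝ => s / h * x := by fun_prop
  have hint : IntegrableOn (fun x : ℝ => s / h * x) (Set.Ioo 0 h) :=
    (hcont.integrableOn_Icc (a := 0) (b := h)).mono_set Set.Ioo_subset_Icc_self
  rw [hset, measureReal_def, Complex.volume_preserving_equiv_real_prod.measure_preimage
    (measurableSet_regionBetween (by fun_prop) (by fun_prop) measurableSet_Ioo).nullMeasurableSet,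
    Measure.volume_eq_prod,
    volume_regionBetween_eq_integral (f := fun x => -(s / h * x)) hint.neg hint measurableSet_Ioo,
    ENNReal.toReal_ofReal]
  · have : ∀ x : ℝ, ((fun x => s / h * x) - fun x => -(s / h * x)) x = 2 * (s / h) * x := by
      intro x; simp; ring
    simp_rw [this]
    rw [← integral_Ioc_eq_integral_Ioo, ← intervalIntegral.integral_of_le hh.le,
      intervalIntegral.integral_const_mul, integral_id]
    field_simp
    ring
  · refine setIntegral_nonneg measurableSet_Ioo fun x hx => ?_
    have : 0 ≤ s / h * x := mul_nonneg (by positivity) hx.1.le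
    simp; linarith
  · intro x hx
    have : 0 ≤ s / h * x := mul_nonneg (by positivity) hx.1.le
    simp; linarith

/-- The chord `re = h` cuts the sector into the segment and an isosceles triangle with apex 0. -/
lemma volume_real_circularSector_eq_add {R h : ℝ} (hh : 0 < h) (hR : h ≤ R) :
    volume.real (circularSector R ((2 * h : ℝ) : ℂ)) =
      volume.real (circularSegment R ((2 * h : ℝ) : ℂ)) + h * √(R ^ 2 - h ^ 2) := by
  have hR0 : 0 < R := hh.trans_le hR
  have hset : circularSector R ((2 * h : ℝ) : ℂ) = circularSegment R ((2 * h : ℝ) : ℂ) ∪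
      {z : ℂ | z.re < h ∧ ‖z‖ * h < R * z.re} := by
    ext z
    rw [Set.mem_union, mem_circularSector_ofReal hh, mem_circularSegment_ofReal hh,
      Set.mem_ofPred_eq]
    constructor
    · rintro ⟨h1, h2⟩
      rcases lt_or_ge z.re h with h3 | h3
      · exact Or.inr ⟨h3, h2⟩
      · exact Or.inl ⟨h1, h3⟩
    · rintro (⟨h1, h2⟩ | ⟨h1, h2⟩)
      · exact ⟨h1, by nlinarith⟩
      · exact ⟨by nlinarith, h2⟩
  have hm : MeasurableSet {z : ℂ | z.re < h ∧ ‖z‖ * h < R * z.re} := by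
    refine (IsOpen.and (isOpen_lt ?_ ?_) (isOpen_lt ?_ ?_)).measurableSet <;> fun_prop
  have hfin : ∀ s ⊆ circularSector R ((2 * h : ℝ) : ℂ), volume s ≠ ⊤ := fun s hs =>
    ((measure_mono (hs.trans (circularSector_subset_ball _ _))).trans_lt measure_ball_lt_top).ne
  rw [← volume_real_triangle hh hR, hset, measureReal_union _ hm
    (hfin _ (hset ▸ Set.subset_union_left)) (hfin _ (hset ▸ Set.subset_union_right))]
  rw [Set.disjoint_left]
  intro z hz hz'
  exact absurd ((mem_circularSegment_ofReal hh).1 hz).2 (not_le.2 hz'.1)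

/-! ### Comparison of segment and sector by concavity of sine -/

lemma three_mul_sqrt_three_div_two_pi_lt_one : 3 * √3 / (2 * Real.pi) < 1 := by
  have h3 : √3 < 2 := by
    rw [Real.sqrt_lt' two_pos]; norm_num
  rw [div_lt_one (by positivity)]
  linarith [Real.pi_gt_three]

/-- The left side is the chord of the sine graph from 0 to π/3. -/
lemma mul_lt_sin_of_lt_pi_div_three {x : ℝ} (h0 : 0 < x) (h1 : x < Real.pi / 3) :
    3 * √3 / (2 * Real.pi) * x < Real.sin x := by
  have hπ := Real.pi_pos
  have ht0 : 0 < 3 * x / Real.pi := by positivity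
  have ht1 : 0 < 1 - 3 * x / Real.pi := by
    rw [sub_pos, div_lt_one hπ]; linarith
  have := strictConcaveOn_sin_Icc.2 (x := 0) (y := Real.pi / 3) ⟨le_rfl, hπ.le⟩
    ⟨by positivity, by linarith⟩ (by positivity) ht1 ht0 (by ring)
  simp only [smul_eq_mul, Real.sin_zero, mul_zero, zero_add, Real.sin_pi_div_three] at this
  rw [show 3 * x / Real.pi * (Real.pi / 3) = x by field_simp] at this
  refine lt_of_eq_of_lt ?_ this
  field_simp

lemma mul_le_sin_of_le_pi_div_three {x : ℝ} (h0 : 0 ≤ x) (h1 : x ≤ Real.pi / 3) :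
    3 * √3 / (2 * Real.pi) * x ≤ Real.sin x := by
  rcases h0.eq_or_lt with rfl | h0
  · simp
  rcases h1.eq_or_lt with rfl | h1
  · rw [Real.sin_pi_div_three]
    have := Real.pi_pos
    apply le_of_eq; field_simp
  · exact (mul_lt_sin_of_lt_pi_div_three h0 h1).le

lemma mul_sqrt_sub_eq_sin_arccos {R h : ℝ} (hh : 0 < h) (hR : h ≤ R) :
    h * √(R ^ 2 - h ^ 2) = R ^ 2 * Real.sin (2 * Real.arccos (h / R)) / 2 := by
  have hR0 : 0 < R := hh.trans_le hR
  rw [Real.sin_two_mul, Real.sin_arccos, Real.cos_arccos (by linarith [div_pos hh hR0])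
    ((div_le_one hR0).2 hR)]
  have : R ^ 2 - h ^ 2 = R ^ 2 * (1 - (h / R) ^ 2) := by field_simp
  rw [this, Real.sqrt_mul (sq_nonneg R), Real.sqrt_sq hR0.le]
  field_simp

lemma arccos_le_pi_div_six {R h : ℝ} (hR : 0 < R) (h1 : √3 * R ≤ 2 * h) :
    Real.arccos (h / R) ≤ Real.pi / 6 := by
  have hπ := Real.pi_pos
  rw [← Real.arccos_cos (x := Real.pi / 6) (by positivity) (by linarith), Real.cos_pi_div_six]
  apply Real.antitone_arccos
  rw [le_div_iff₀ hR]; linarith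

lemma arccos_lt_pi_div_six {R h : ℝ} (hR : 0 < R) (h0 : h ≤ R) (h1 : √3 * R < 2 * h) :
    Real.arccos (h / R) < Real.pi / 6 := by
  have hπ := Real.pi_pos
  rw [← Real.arccos_cos (x := Real.pi / 6) (by positivity) (by linarith), Real.cos_pi_div_six]
  apply Real.strictAntiOn_arccos
  · constructor
    · linarith [Real.sqrt_nonneg 3]
    · have : √3 ≤ 2 := by rw [Real.sqrt_le_left two_pos.le]; norm_num
      linarith
  · exact ⟨by linarith [div_nonneg ((by positivity : 0 ≤ √3 * R).trans h1.le) hR.le,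
      show 2 * h / R = 2 * (h / R) by ring], (div_le_one hR).2 h0⟩
  · rw [lt_div_iff₀ hR]; linarith

lemma exists_linearIsometryEquiv_norm_eq {a : ℂ} (ha : a ≠ 0) :
    ∃ e : ℂ ≃ₗᵢ[ℝ] ℂ, e (‖a‖ : ℂ) = a := by
  have hn : (‖a‖ : ℂ) ≠ 0 := by simpa using ha
  let u : Circle := ⟨a / ‖a‖, mem_sphere_zero_iff_norm.2 (by simp [ha])⟩
  exact ⟨rotation u, div_mul_cancel₀ _ hn⟩

lemma volume_real_circularSector_norm {a : ℂ} (ha : a ≠ 0) (R : ℝ) :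
    volume.real (circularSector R (‖a‖ : ℂ)) = volume.real (circularSector R a) := by
  obtain ⟨e, he⟩ := exists_linearIsometryEquiv_norm_eq ha
  rw [measureReal_def, measureReal_def, ← e.measurePreserving.measure_preimage
    (isOpen_circularSector R a).measurableSet.nullMeasurableSet]
  congr 2
  ext z
  have : inner ℝ (e z) a = inner ℝ z (‖a‖ : ℂ) := by
    conv_lhs => rw [← he]
    exact e.inner_map_map _ _
  simp [circularSector, this, -Complex.inner]

lemma volume_real_circularSegment_norm {a : ℂ} (ha : a ≠ 0) (R : ℝ) :
    volume.real (circularSegment R (‖a‖ : ℂ)) = volume.real (circularSegment R a) := by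
  obtain ⟨e, he⟩ := exists_linearIsometryEquiv_norm_eq ha
  rw [measureReal_def, measureReal_def, ← e.measurePreserving.measure_preimage
    (measurableSet_circularSegment R a).nullMeasurableSet]
  congr 2
  ext z
  have : inner ℝ (e z) a = inner ℝ z (‖a‖ : ℂ) := by
    conv_lhs => rw [← he]
    exact e.inner_map_map _ _
  simp [circularSegment, this, -Complex.inner]

lemma volume_real_circularSegment {R : ℝ} {a : ℂ} (ha : 0 < ‖a‖) (ha2 : ‖a‖ ≤ 2 * R) :
    volume.real (circularSegment R a) = volume.real (circularSector R a) -
      R ^ 2 * Real.sin (2 * Real.arccos (‖a‖ / 2 / R)) / 2 := by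
  have h0 : 0 < ‖a‖ / 2 := by positivity
  have h1 : ‖a‖ / 2 ≤ R := by linarith
  have := volume_real_circularSector_eq_add h0 h1
  rw [show 2 * (‖a‖ / 2) = ‖a‖ by ring, mul_sqrt_sub_eq_sin_arccos h0 h1,
    volume_real_circularSector_norm (norm_pos_iff.1 ha),
    volume_real_circularSegment_norm (norm_pos_iff.1 ha)] at this
  linarith

lemma volume_real_circularSector {R : ℝ} {a : ℂ} (ha : 0 < ‖a‖) (ha2 : ‖a‖ ≤ 2 * R) :
    volume.real (circularSector R a) = R ^ 2 * Real.arccos (‖a‖ / 2 / R) := by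
  rw [← volume_real_circularSector_norm (norm_pos_iff.1 ha),
    ← volume_real_circularSector_ofReal (by positivity) (by linarith),
    show 2 * (‖a‖ / 2) = ‖a‖ by ring]

lemma volume_real_circularSegment_le {R : ℝ} (hR : 0 < R) {a : ℂ} (ha : √3 * R ≤ ‖a‖)
    (ha2 : ‖a‖ ≤ 2 * R) : volume.real (circularSegment R a) ≤
      (1 - 3 * √3 / (2 * Real.pi)) * volume.real (circularSector R a) := by
  have h0 : 0 < ‖a‖ := lt_of_lt_of_le (by positivity) ha
  have h1 := arccos_le_pi_div_six (h := ‖a‖ / 2) hR (by linarith)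
  have h2 := mul_le_sin_of_le_pi_div_three (x := 2 * Real.arccos (‖a‖ / 2 / R))
    (by linarith [Real.arccos_nonneg (‖a‖ / 2 / R)]) (by linarith)
  rw [volume_real_circularSegment h0 ha2, volume_real_circularSector h0 ha2]
  nlinarith [mul_le_mul_of_nonneg_left h2 (sq_nonneg R)]

lemma volume_real_circularSegment_lt {R : ℝ} (hR : 0 < R) {a : ℂ} (ha : √3 * R < ‖a‖)
    (ha2 : ‖a‖ < 2 * R) : volume.real (circularSegment R a) <
      (1 - 3 * √3 / (2 * Real.pi)) * volume.real (circularSector R a) := by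
  have h0 : 0 < ‖a‖ := lt_of_le_of_lt (by positivity) ha
  have h1 := arccos_lt_pi_div_six (h := ‖a‖ / 2) hR (by linarith) (by linarith)
  have h3 : 0 < Real.arccos (‖a‖ / 2 / R) := by
    rw [Real.arccos_pos, div_lt_one hR]; linarith
  have h2 := mul_lt_sin_of_lt_pi_div_three (x := 2 * Real.arccos (‖a‖ / 2 / R))
    (by linarith) (by linarith)
  rw [volume_real_circularSegment h0 ha2.le, volume_real_circularSector h0 ha2.le]
  nlinarith [mul_lt_mul_of_pos_left h2 (pow_pos hR 2)]

/-- If z were in both sectors, p = (R/‖z‖)z would be at distance R from 0 and less than R from a and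
b. But the squared distances from p to the vertices of the triangle 0, a, b sum to at least a third
of the sum of the squared sides, hence to at least 3R². The inequality ‖3p - (a + b)‖² ≥ 0 expresses
this, scaled by ‖z‖. -/
lemma disjoint_circularSector {R : ℝ} {a b : ℂ} (hR : 0 ≤ R) (ha : √3 * R ≤ ‖a‖)
    (hb : √3 * R ≤ ‖b‖) (hab : √3 * R ≤ ‖a - b‖) :
    Disjoint (circularSector R a) (circularSector R b) := by
  rw [Set.disjoint_left]
  rintro z ⟨-, hza⟩ ⟨-, hzb⟩
  have hsq : ∀ {c : ℂ}, √3 * R ≤ ‖c‖ → 3 * R ^ 2 ≤ ‖c‖ ^ 2 := fun {c} hc => by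
    have := pow_le_pow_left₀ (by positivity) hc 2
    rwa [mul_pow, Real.sq_sqrt (by norm_num)] at this
  have hz : 0 < ‖z‖ := by
    rw [norm_pos_iff]
    rintro rfl
    simp at hza
  have h1 := sq_nonneg ‖(3 * R) • z - ‖z‖ • (a + b)‖
  rw [norm_sub_sq_real, norm_smul, norm_smul, inner_smul_left, inner_smul_right, inner_add_right,
    mul_pow, mul_pow, norm_add_sq_real] at h1
  have h2 := norm_sub_sq_real a b
  have h3 := hsq ha
  have h4 := hsq hb
  have h5 := hsq hab
  simp only [Real.norm_eq_abs, sq_abs, abs_norm, conj_trivial] at h1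
  have h6 := mul_lt_mul_of_pos_left (add_lt_add hza hzb) hz
  have h7 : 0 < ‖z‖ ^ 2 := by positivity
  have h8 : ‖z‖ ^ 2 * (9 * R ^ 2) < ‖z‖ ^ 2 * (9 * R ^ 2) := by
    nlinarith [mul_le_mul_of_nonneg_left (add_le_add (add_le_add h3 h4) h5) h7.le]
  exact lt_irrefl _ h8

/-! ### Lower bound for the area of a truncated cell -/

/-- The part of the open disk of radius `R` about `0` that lies closer to `0` than to each
point of `N`. -/
def truncatedCell (R : ℝ) (N : Set ℂ) : Set ℂ :=
  {z | ‖z‖ < R ∧ ∀ a ∈ N, 2 * inner ℝ z a < ‖a‖ ^ 2}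

lemma Complex.volume_real_ball (z : ℂ) {R : ℝ} (hR : 0 ≤ R) :
    volume.real (Metric.ball z R) = Real.pi * R ^ 2 := by
  rw [measureReal_def, Complex.volume_ball]
  simp [hR]; ring

lemma le_volume_real_truncatedCell_add {R : ℝ} (hR : 0 ≤ R) (N : Finset ℂ) :
    Real.pi * R ^ 2 ≤ volume.real (truncatedCell R N) +
      ∑ a ∈ N, volume.real (circularSegment R a) := by
  have hsub : Metric.ball 0 R ⊆ truncatedCell R N ∪ ⋃ a ∈ N, circularSegment R a := by
    intro z hz
    have hz' : ‖z‖ < R := by simpa using hz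
    by_cases h : z ∈ truncatedCell R N
    · exact Or.inl h
    · right
      simp only [truncatedCell, Set.mem_ofPred_eq, not_and, not_forall, not_lt] at h
      obtain ⟨a, ha, h⟩ := h hz'
      exact Set.mem_biUnion ha ⟨hz', h⟩
  have hV : truncatedCell R N ⊆ Metric.ball 0 R := fun z hz => by simpa using hz.1
  have hfin : volume (truncatedCell R N ∪ ⋃ a ∈ N, circularSegment R a) ≠ ⊤ :=
    ((measure_mono (Set.union_subset hV (Set.iUnion₂_subset fun a _ =>
      circularSegment_subset_ball R a))).trans_lt measure_ball_lt_top).ne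
  rw [← Complex.volume_real_ball 0 hR]
  exact (measureReal_mono hsub hfin).trans ((measureReal_union_le _ _).trans
    (add_le_add_right (measureReal_biUnion_finset_le _ _) _))

lemma sum_volume_real_circularSector_add_le {R : ℝ} (hR : 0 ≤ R) {N : Finset ℂ}
    (hN : ∀ a ∈ N, √3 * R ≤ ‖a‖) (hN' : ∀ a ∈ N, ∀ b ∈ N, a ≠ b → √3 * R ≤ ‖a - b‖)
    {U : Set ℂ} (hUR : U ⊆ Metric.ball 0 R)
    (hUN : ∀ a ∈ N, Disjoint U (circularSector R a)) :
    volume.real U + ∑ a ∈ N, volume.real (circularSector R a) ≤ Real.pi * R ^ 2 := by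
  have hfin : ∀ s ⊆ Metric.ball (0 : ℂ) R, volume s ≠ ⊤ := fun s hs =>
    ((measure_mono hs).trans_lt measure_ball_lt_top).ne
  have hm : ∀ a ∈ N, MeasurableSet (circularSector R a) :=
    fun a _ => (isOpen_circularSector R a).measurableSet
  have hsub : (⋃ a ∈ N, circularSector R a) ⊆ Metric.ball 0 R :=
    Set.iUnion₂_subset fun a _ => circularSector_subset_ball R a
  rw [← measureReal_biUnion_finset
    (fun a ha b hb hab => disjoint_circularSector hR (hN a ha) (hN b hb) (hN' a ha b hb hab)) hm
    (fun a _ => hfin _ (circularSector_subset_ball R a)),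
    ← measureReal_union (Set.disjoint_iUnion₂_right.2 hUN) (N.measurableSet_biUnion hm)
      (hfin _ hUR) (hfin _ hsub), ← Complex.volume_real_ball 0 hR]
  exact measureReal_mono (Set.union_subset hUR hsub) measure_ball_lt_top.ne

lemma le_volume_real_truncatedCell {R : ℝ} (hR : 0 < R) {N : Finset ℂ}
    (hN : ∀ a ∈ N, √3 * R ≤ ‖a‖) (hN2 : ∀ a ∈ N, ‖a‖ < 2 * R)
    (hN' : ∀ a ∈ N, ∀ b ∈ N, a ≠ b → √3 * R ≤ ‖a - b‖) :
    3 * √3 / 2 * R ^ 2 ≤ volume.real (truncatedCell R N) := by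
  have h1 := le_volume_real_truncatedCell_add hR.le N
  have h2 := sum_volume_real_circularSector_add_le hR.le hN hN' (Set.empty_subset _)
    (fun a _ => Set.empty_disjoint _)
  have h3 := Finset.sum_le_sum fun a ha =>
    volume_real_circularSegment_le hR (hN a ha) (hN2 a ha).le
  rw [← Finset.mul_sum] at h3
  rw [measureReal_empty, zero_add] at h2
  have h4 := mul_le_mul_of_nonneg_left h2 (sub_pos.2 three_mul_sqrt_three_div_two_pi_lt_one).le
  have h5 : (1 - 3 * √3 / (2 * Real.pi)) * (Real.pi * R ^ 2) =
      Real.pi * R ^ 2 - 3 * √3 / 2 * R ^ 2 := by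
    have := Real.pi_pos
    field_simp
  linarith

/-! ### The equality case: hexagonal neighborhoods -/

/-- Here `w` is `a` turned by 60° either way. All sectors have half-angle 30°, so if `w` is missing,
a gap opens just beyond the side of the sector of `a` facing `w`. -/
lemma exists_isOpen_disjoint_circularSector {R : ℝ} (hR : 0 < R) {N : Finset ℂ}
    (hN : ∀ a ∈ N, ‖a‖ = √3 * R) (hN' : ∀ a ∈ N, ∀ b ∈ N, a ≠ b → √3 * R ≤ ‖a - b‖)
    {a w : ℂ} (ha : a ∈ N) (hw : ‖w‖ = √3 * R) (haw : inner ℝ a w = 3 * R ^ 2 / 2)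
    (hwN : w ∉ N) : ∃ U : Set ℂ, IsOpen U ∧ U.Nonempty ∧ U ⊆ Metric.ball 0 R ∧
      ∀ b ∈ N, Disjoint U (circularSector R b) := by
  have hsq : ∀ b ∈ N, ‖b‖ ^ 2 = 3 * R ^ 2 := fun b hb => by
    rw [hN b hb, mul_pow, Real.sq_sqrt (by norm_num)]
  have hw2 : ‖w‖ ^ 2 = 3 * R ^ 2 := by rw [hw, mul_pow, Real.sq_sqrt (by norm_num)]
  -- At t = 0 the point lies on the ray bounding the sectors of both `a` and `w`, halfway to the
  -- circle; increasing t moves it out of the sector of `a`.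
  set z : ℝ → ℂ := fun t => (1 / 6 : ℝ) • (a + w) + t • (w - a) with hz
  have hzc : Continuous z := by fun_prop
  have hznorm : ∀ t, ‖z t‖ ^ 2 = R ^ 2 / 4 + 3 * R ^ 2 * t ^ 2 := fun t => by
    simp only [hz, norm_add_sq_real, norm_smul, mul_pow, inner_smul_left, inner_smul_right,
      inner_add_left, inner_sub_right, norm_sub_sq_real, real_inner_self_eq_norm_sq,
      real_inner_comm a w, hw2, hsq a ha, Real.norm_eq_abs, sq_abs, conj_trivial, haw]
    ring
  have hz0 : ‖z 0‖ = R / 2 := by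
    rw [← sq_eq_sq₀ (norm_nonneg _) (by positivity), hznorm]; ring
  have hza : ∀ t, inner ℝ (z t) a = 3 * R ^ 2 / 4 - 3 * R ^ 2 / 2 * t := fun t => by
    simp only [hz, inner_add_left, inner_smul_left, inner_sub_left, real_inner_self_eq_norm_sq,
      real_inner_comm a w, hsq a ha, haw, conj_trivial]
    ring
  set U : Set ℂ := Metric.ball 0 R ∩ ⋂ b ∈ N, {x | 2 * R * inner ℝ x b < ‖x‖ * ‖b‖ ^ 2} with hU
  set U' : Set ℂ := Metric.ball 0 R ∩
    ⋂ b ∈ N.erase a, {x | 2 * R * inner ℝ x b < ‖x‖ * ‖b‖ ^ 2} with hU'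
  have hop : ∀ b : ℂ, IsOpen {x : ℂ | 2 * R * inner ℝ x b < ‖x‖ * ‖b‖ ^ 2} := fun b =>
    isOpen_lt (by fun_prop) (by fun_prop)
  have hU'o : IsOpen U' := Metric.isOpen_ball.inter (isOpen_biInter_finset fun b _ => hop b)
  have h0 : z 0 ∈ U' := by
    refine ⟨by simpa [hz0] using hR, Set.mem_iInter₂.2 fun b hb => ?_⟩
    obtain ⟨hba, hb⟩ := Finset.mem_erase.1 hb
    -- Separation gives ⟨a, b⟩ ≤ 3R²/2, so `z 0` in the closed sector of `b` forces ⟨w, b⟩ ≥ 3R²,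
    -- that is, w = b.
    by_contra hc
    rw [Set.mem_ofPred_eq, not_lt, hz0, hsq b hb] at hc
    apply hwN
    have e1 : inner ℝ (z 0) b = (1 / 6) * (inner ℝ a b + inner ℝ w b) := by
      simp only [hz, inner_add_left, inner_smul_left, zero_smul, add_zero, conj_trivial]
    have e2 := norm_sub_sq_real a b
    have e3 := norm_sub_sq_real w b
    have e4 := pow_le_pow_left₀ (by positivity) (hN' a ha b hb (Ne.symm hba)) 2
    rw [mul_pow, Real.sq_sqrt (by norm_num)] at e4
    rw [hsq a ha, hsq b hb] at e2
    rw [hw2, hsq b hb] at e3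
    have e5 : 3 * R ^ 2 / 4 ≤ inner ℝ (z 0) b := by
      have : R * (3 * R ^ 2 / 4) ≤ R * inner ℝ (z 0) b := by linarith
      exact le_of_mul_le_mul_left this hR
    have e6 : ‖w - b‖ ^ 2 ≤ 0 := by nlinarith
    have e7 : ‖w - b‖ = 0 := pow_eq_zero_iff two_ne_zero |>.1 (le_antisymm e6 (sq_nonneg _))
    rw [sub_eq_zero.1 (norm_eq_zero.1 e7)]
    exact hb
  have hev : ∀ᶠ t in nhdsWithin (0 : ℝ) (Set.Ioi 0), z t ∈ U' :=
    (hzc.continuousAt.eventually (hU'o.mem_nhds h0)).filter_mono nhdsWithin_le_nhds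
  obtain ⟨t, ht, ht0⟩ := (hev.and self_mem_nhdsWithin).exists
  refine ⟨U, Metric.isOpen_ball.inter (isOpen_biInter_finset fun b _ => hop b), ⟨z t, ht.1, ?_⟩,
    Set.inter_subset_left, fun b hb => ?_⟩
  · refine Set.mem_iInter₂.2 fun b hb => ?_
    by_cases hba : b = a
    · subst hba
      have h1 : R / 2 ≤ ‖z t‖ := by
        refine le_of_sq_le_sq ?_ (norm_nonneg _)
        rw [hznorm]
        nlinarith [sq_nonneg (R * t)]
      rw [Set.mem_ofPred_eq, hza, hsq b hb]
      have h2 : 0 < R ^ 3 * t := mul_pos (pow_pos hR 3) ht0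
      nlinarith [mul_le_mul_of_nonneg_right h1 (by positivity : 0 ≤ 3 * R ^ 2)]
    · exact Set.mem_iInter₂.1 ht.2 b (Finset.mem_erase.2 ⟨hba, hb⟩)
  · rw [Set.disjoint_left]
    intro x hx hx'
    exact lt_asymm hx'.2 (Set.mem_iInter₂.1 hx.2 b hb)

/-- Minimal area leaves no slack: a neighbor farther than √3 R loses by strict concavity, and an
open set missed by all sectors loses its own area. -/
lemma hexagonal_of_volume_real_truncatedCell_le {R : ℝ} (hR : 0 < R) {N : Finset ℂ}
    (hN : ∀ a ∈ N, √3 * R ≤ ‖a‖) (hN2 : ∀ a ∈ N, ‖a‖ < 2 * R)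
    (hN' : ∀ a ∈ N, ∀ b ∈ N, a ≠ b → √3 * R ≤ ‖a - b‖)
    (hV : volume.real (truncatedCell R N) ≤ 3 * √3 / 2 * R ^ 2) :
    N.Nonempty ∧ ∀ a ∈ N, ‖a‖ = √3 * R ∧
      ∀ w : ℂ, ‖w‖ = √3 * R → inner ℝ a w = 3 * R ^ 2 / 2 → w ∈ N := by
  have h1 := le_volume_real_truncatedCell_add hR.le N
  have hκ := sub_pos.2 three_mul_sqrt_three_div_two_pi_lt_one
  have h5 : (1 - 3 * √3 / (2 * Real.pi)) * (Real.pi * R ^ 2) =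
      Real.pi * R ^ 2 - 3 * √3 / 2 * R ^ 2 := by
    have := Real.pi_pos
    field_simp
  have hle : ∀ a ∈ N, volume.real (circularSegment R a) ≤
      (1 - 3 * √3 / (2 * Real.pi)) * volume.real (circularSector R a) := fun a ha =>
    volume_real_circularSegment_le hR (hN a ha) (hN2 a ha).le
  have key : ∀ U : Set ℂ, U ⊆ Metric.ball 0 R →
      (∀ a ∈ N, Disjoint U (circularSector R a)) → volume.real U ≤ 0 := by
    intro U hUR hUN
    have h2 := sum_volume_real_circularSector_add_le hR.le hN hN' hUR hUN
    have h3 := Finset.sum_le_sum hle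
    rw [← Finset.mul_sum] at h3
    have h4 := mul_le_mul_of_nonneg_left h2 hκ.le
    rw [mul_add] at h4
    have : (1 - 3 * √3 / (2 * Real.pi)) * volume.real U ≤ 0 := by linarith
    by_contra hc
    linarith [mul_pos hκ (not_le.1 hc)]
  have hnorm : ∀ a ∈ N, ‖a‖ = √3 * R := by
    by_contra! hc
    obtain ⟨a, ha, hne⟩ := hc
    have h2 := sum_volume_real_circularSector_add_le hR.le hN hN' (Set.empty_subset _)
      (fun a _ => Set.empty_disjoint _)
    have h3 := Finset.sum_lt_sum hle ⟨a, ha, volume_real_circularSegment_lt hR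
      (lt_of_le_of_ne (hN a ha) hne.symm) (hN2 a ha)⟩
    rw [← Finset.mul_sum] at h3
    rw [measureReal_empty, zero_add] at h2
    have h4 := mul_le_mul_of_nonneg_left h2 hκ.le
    linarith
  have hpos : ∀ U : Set ℂ, IsOpen U → U.Nonempty → U ⊆ Metric.ball 0 R → 0 < volume.real U :=
    fun U hU hne hsub => ENNReal.toReal_pos (hU.measure_pos _ hne).ne'
      ((measure_mono hsub).trans_lt measure_ball_lt_top).ne
  constructor
  · by_contra hc
    rw [Finset.not_nonempty_iff_eq_empty] at hc
    subst hc
    exact (hpos _ Metric.isOpen_ball ⟨0, by simpa using hR⟩ subset_rfl).not_ge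
      (key _ subset_rfl (by simp))
  · intro a ha
    refine ⟨hnorm a ha, fun w hw haw => ?_⟩
    by_contra hwN
    obtain ⟨U, hU, hne, hsub, hdisj⟩ :=
      exists_isOpen_disjoint_circularSector hR hnorm hN' ha hw haw hwN
    exact (hpos U hU hne hsub).not_ge (key U hsub hdisj)

/-! ### Area and balls on the square torus -/

namespace SquareTorus

variable {L : ℝ}

lemma proj_eq_proj_iff {x y : Plane} : proj L x = proj L y ↔ y - x ∈ squareLattice L := by
  rw [proj, proj, QuotientAddGroup.eq, neg_add_eq_sub]

lemma proj_add_of_mem {v : Plane} (hv : v ∈ squareLattice L) (x : Plane) :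
    proj L (x + v) = proj L x :=
  (proj_eq_proj_iff.2 (by simpa using hv)).symm

lemma dist_proj_le (x y : Plane) : dist (proj L x) (proj L y) ≤ dist x y := by
  rw [dist_eq_norm, dist_eq_norm]
  exact QuotientAddGroup.norm_mk_le_norm (m := x - y) (S := squareLattice L)

lemma continuous_proj : Continuous (proj L) := continuous_quot_mk

lemma measurable_proj : Measurable (proj L) := measurable_quot_mk

instance : Countable (squareLattice L) := by
  choose k hk using fun v : squareLattice L => v.2
  refine Function.Injective.countable (f := k) fun v w h => ?_
  ext i
  rw [hk v i, hk w i, h]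

lemma measurableSet_fundamentalSquare : MeasurableSet (fundamentalSquare L) := by
  have : fundamentalSquare L = ⋂ i, (fun x : Plane => x i) ⁻¹' Set.Ico 0 L := by
    ext x; simp [fundamentalSquare]
  rw [this]
  exact MeasurableSet.iInter fun i => measurableSet_Ico.preimage (by fun_prop)

lemma isAddFundamentalDomain_fundamentalSquare (hL : 0 < L) :
    IsAddFundamentalDomain (squareLattice L) (fundamentalSquare L) volume := by
  refine IsAddFundamentalDomain.mk' measurableSet_fundamentalSquare.nullMeasurableSet fun x => ?_
  choose k hk hk' using fun i => existsUnique_add_zsmul_mem_Ico hL (x i) 0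
  have hmem : (WithLp.toLp 2 fun i => (k i : ℝ) * L : Plane) ∈ squareLattice L :=
    fun i => ⟨k i, rfl⟩
  refine ⟨⟨_, hmem⟩, fun i => ?_, fun v hv => ?_⟩
  · have := hk i
    simpa [AddSubgroup.vadd_def, add_comm] using this
  · ext i
    obtain ⟨m, hm⟩ := v.2 i
    have hvi := hv i
    have hmk : m = k i := hk' i m (by simpa [AddSubgroup.vadd_def, add_comm, hm] using hvi)
    rw [hm, hmk]

lemma volume_fundamentalSquare (hL : 0 ≤ L) :
    volume (fundamentalSquare L) = ENNReal.ofReal (L ^ 2) := by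
  have : fundamentalSquare L = (WithLp.ofLp : Plane → Fin 2 → ℝ) ⁻¹'
      Set.univ.pi fun _ => Set.Ico 0 L := by
    ext x; simp [fundamentalSquare]
  rw [this, (PiLp.volume_preserving_ofLp (Fin 2)).measure_preimage
    (MeasurableSet.univ_pi fun _ => measurableSet_Ico).nullMeasurableSet, volume_pi_pi]
  simp [ENNReal.ofReal_pow hL]

lemma area_real_univ (hL : 0 ≤ L) : (area L).real Set.univ = L ^ 2 := by
  rw [measureReal_def, area, Measure.map_apply measurable_proj MeasurableSet.univ,
    Set.preimage_univ, Measure.restrict_apply_univ, volume_fundamentalSquare hL,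
    ENNReal.toReal_ofReal (by positivity)]

lemma proj_preimage_ball (x : Plane) (r : ℝ) :
    proj L ⁻¹' Metric.ball (proj L x) r = ⋃ v : squareLattice L, v +ᵥ Metric.ball x r := by
  ext y
  rw [Set.mem_preimage, Metric.mem_ball, Set.mem_iUnion, dist_eq_norm]
  constructor
  · intro h
    obtain ⟨m, hm, hmr⟩ := QuotientAddGroup.norm_lt_iff.1 h
    have hmem : y - x - m ∈ squareLattice L := by
      have : proj L m = proj L (y - x) := hm
      exact proj_eq_proj_iff.1 this
    refine ⟨⟨_, hmem⟩, Set.mem_vadd_set.2 ⟨x + m, ?_, ?_⟩⟩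
    · rw [Metric.mem_ball, dist_self_add_left]
      exact hmr
    · rw [AddSubgroup.vadd_def, vadd_eq_add]
      simp
  · rintro ⟨v, hv⟩
    obtain ⟨z, hz, rfl⟩ := Set.mem_vadd_set.1 hv
    have : proj L (v +ᵥ z) = proj L z := by
      rw [AddSubgroup.vadd_def, vadd_eq_add, add_comm]
      exact proj_add_of_mem v.2 z
    rw [this, ← dist_eq_norm]
    exact (dist_proj_le z x).trans_lt hz

lemma area_ball_le (hL : 0 < L) (x : Plane) (r : ℝ) :
    area L (Metric.ball (proj L x) r) ≤ volume (Metric.ball x r) := by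
  have hm : MeasurableSet (proj L ⁻¹' Metric.ball (proj L x) r) :=
    (Metric.isOpen_ball.preimage continuous_proj).measurableSet
  rw [area, Measure.map_apply measurable_proj (measurableSet_quotient.2 hm),
    Measure.restrict_apply hm, proj_preimage_ball, Set.iUnion_inter,
    (isAddFundamentalDomain_fundamentalSquare hL).measure_eq_tsum (Metric.ball x r)]
  exact measure_iUnion_le (μ := volume) fun v : squareLattice L => (v +ᵥ Metric.ball x r) ∩ _

end SquareTorus

/-! ### Separation of the centers and a density bound -/

namespace DiskPacking

open SquareTorus

variable {L : ℝ} {n : ℕ}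

lemma two_mul_radius_le_dist (P : DiskPacking L n) {x y : Plane} (hxy : x ≠ y)
    (hx : proj L x ∈ Set.range P.center) (hy : proj L y ∈ Set.range P.center) :
    2 * P.radius ≤ dist x y := by
  obtain ⟨i, hi⟩ := hx
  obtain ⟨j, hj⟩ := hy
  by_contra! hc
  have hmx : dist (midpoint ℝ x y) x < P.radius := by
    rw [dist_midpoint_left]; simp; linarith
  have hmy : dist (midpoint ℝ x y) y < P.radius := by
    rw [dist_midpoint_right]; simp; linarith
  by_cases hij : i = j
  · subst hij
    have hyx : y - x ∈ squareLattice L := proj_eq_proj_iff.1 (hi.symm.trans hj)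
    have hxm : x ∈ Metric.ball (midpoint ℝ x y) P.radius := by
      rwa [Metric.mem_ball, dist_comm]
    have hym : y ∈ Metric.ball (midpoint ℝ x y) P.radius := by
      rwa [Metric.mem_ball, dist_comm]
    -- The disk about the midpoint contains `x` and `y`, which differ by a lattice vector.
    -- Translation by `u` carries this pair into the disk about `x`, where `embedded` applies.
    set u : Plane := x - midpoint ℝ x y with hu
    have hinj := P.embedded x i hi.symm
    refine hxy ?_
    have h1 : x + u ∈ Metric.ball x P.radius := by
      rw [Metric.mem_ball, dist_self_add_left, ← dist_eq_norm]
      exact hxm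
    have h2 : x + u + (y - x) ∈ Metric.ball x P.radius := by
      have : x + u + (y - x) - x = y - midpoint ℝ x y := by
        rw [hu, midpoint_eq_smul_add]; module
      rw [Metric.mem_ball, dist_eq_norm, this, ← dist_eq_norm]
      exact hym
    have := hinj h2 h1 (proj_add_of_mem hyx _)
    rw [add_eq_left, sub_eq_zero] at this
    exact this.symm
  · have hd := P.disjoint i j hij
    rw [Set.disjoint_left] at hd
    refine hd (a := proj L (midpoint ℝ x y)) ?_ ?_
    · rw [hi]; exact (dist_proj_le _ _).trans_lt hmx
    · rw [hj]; exact (dist_proj_le _ _).trans_lt hmy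

lemma center_injective (P : DiskPacking L n) : Function.Injective P.center := by
  intro i j hij
  by_contra hne
  have := P.disjoint i j hne
  rw [hij, disjoint_self, Set.bot_eq_empty, Metric.ball_eq_empty] at this
  exact absurd P.radius_pos this.not_gt

lemma density_le (hL : 0 < L) (P : DiskPacking L n) :
    P.density ≤ n * (Real.pi * P.radius ^ 2) / L ^ 2 := by
  rw [density, area_real_univ hL.le]
  refine div_le_div_of_nonneg_right ?_ (sq_nonneg L)
  refine (measureReal_iUnion_fintype_le _).trans ?_
  have : ∀ i ∈ Finset.univ, (area L).real (Metric.ball (P.center i) P.radius) ≤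
      Real.pi * P.radius ^ 2 := by
    intro i _
    obtain ⟨x, hx⟩ := QuotientAddGroup.mk_surjective (P.center i)
    rw [← hx]
    refine ENNReal.toReal_le_of_le_ofReal (by have := Real.pi_pos; positivity)
      ((area_ball_le hL x P.radius).trans_eq ?_)
    rw [EuclideanSpace.volume_ball_fin_two, mul_comm, ENNReal.ofReal_mul Real.pi_pos.le,
      ENNReal.ofReal_pow P.radius_pos.le]
  simpa using Finset.sum_le_sum this

end DiskPacking

/-! ### Truncated Voronoi cells of a separated set -/

/-- The differences `x - c` for the points `x ≠ c` of `X` at distance less than `2 * R`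
from `c`. -/
def neighborVectors (R : ℝ) (X : Set ℂ) (c : ℂ) : Set ℂ :=
  {a | a ≠ 0 ∧ c + a ∈ X ∧ ‖a‖ < 2 * R}

/-- The Voronoi cell of `c` in `X`, intersected with the open disk of radius `R` about `c`. -/
def truncatedVoronoiCell (R : ℝ) (X : Set ℂ) (c : ℂ) : Set ℂ :=
  (fun z => z - c) ⁻¹' truncatedCell R (neighborVectors R X c)

section Separated

variable {R : ℝ} {X : Set ℂ} {c : ℂ}

lemma finite_neighborVectors (hR : 0 < R) (hX : X.Pairwise fun x y => √3 * R ≤ dist x y) (c : ℂ) :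
    (neighborVectors R X c).Finite := by
  have hpos : 0 < √3 * R := by positivity
  have hdisc : IsDiscrete X := by
    refine ⟨DiscreteTopology.of_forall_le_dist hpos fun x y hxy => ?_⟩
    exact hX x.2 y.2 (Subtype.coe_ne_coe.2 hxy)
  have h := Metric.finite_isBounded_inter_isClosed hdisc
    (Metric.isBounded_ball (x := c) (r := 2 * R)) (Metric.isClosed_of_pairwise_le_dist hpos hX)
  refine Set.Finite.of_finite_image (f := fun a => c + a) (h.subset ?_)
    (add_right_injective c).injOn
  rintro _ ⟨a, ha, rfl⟩
  exact ⟨by simpa using ha.2.2, ha.2.1⟩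

lemma le_norm_of_mem_neighborVectors (hX : X.Pairwise fun x y => √3 * R ≤ dist x y)
    (hc : c ∈ X) {a : ℂ} (ha : a ∈ neighborVectors R X c) : √3 * R ≤ ‖a‖ := by
  simpa using hX ha.2.1 hc (by simpa using ha.1)

lemma le_norm_sub_of_mem_neighborVectors (hX : X.Pairwise fun x y => √3 * R ≤ dist x y)
    {a b : ℂ} (ha : a ∈ neighborVectors R X c) (hb : b ∈ neighborVectors R X c) (hab : a ≠ b) :
    √3 * R ≤ ‖a - b‖ := by
  simpa [dist_eq_norm] using hX ha.2.1 hb.2.1 (by simpa using hab)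

lemma isOpen_truncatedVoronoiCell (hR : 0 < R)
    (hX : X.Pairwise fun x y => √3 * R ≤ dist x y) (c : ℂ) :
    IsOpen (truncatedVoronoiCell R X c) := by
  refine IsOpen.preimage (by fun_prop) ?_
  have : truncatedCell R (neighborVectors R X c) = Metric.ball 0 R ∩
      ⋂ a ∈ neighborVectors R X c, {z | 2 * inner ℝ z a < ‖a‖ ^ 2} := by
    ext z; simp [truncatedCell]
  rw [this]
  exact Metric.isOpen_ball.inter ((finite_neighborVectors hR hX c).isOpen_biInter fun a _ =>
    isOpen_lt (by fun_prop) (by fun_prop))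

lemma volume_truncatedVoronoiCell (R : ℝ) (X : Set ℂ) (c : ℂ) :
    volume (truncatedVoronoiCell R X c) = volume (truncatedCell R (neighborVectors R X c)) :=
  by simpa only [truncatedVoronoiCell, sub_eq_add_neg] using
    measure_preimage_add_right volume (-c) (truncatedCell R (neighborVectors R X c))

lemma volume_truncatedVoronoiCell_lt_top : volume (truncatedVoronoiCell R X c) < ⊤ := by
  rw [volume_truncatedVoronoiCell]
  exact (measure_mono fun z hz => by simpa using hz.1).trans_lt
    (measure_ball_lt_top (x := (0 : ℂ)) (r := R))

lemma le_volume_real_truncatedVoronoiCell (hR : 0 < R)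
    (hX : X.Pairwise fun x y => √3 * R ≤ dist x y) (hc : c ∈ X) :
    3 * √3 / 2 * R ^ 2 ≤ volume.real (truncatedVoronoiCell R X c) := by
  rw [measureReal_def, volume_truncatedVoronoiCell, ← measureReal_def]
  have hfin := finite_neighborVectors hR hX c
  rw [← hfin.coe_toFinset]
  apply le_volume_real_truncatedCell hR
  · exact fun a ha => le_norm_of_mem_neighborVectors hX hc (hfin.mem_toFinset.1 ha)
  · exact fun a ha => (hfin.mem_toFinset.1 ha).2.2
  · exact fun a ha b hb hab => le_norm_sub_of_mem_neighborVectors hX (hfin.mem_toFinset.1 ha)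
      (hfin.mem_toFinset.1 hb) hab

lemma hexagonal_of_volume_real_truncatedVoronoiCell_le (hR : 0 < R)
    (hX : X.Pairwise fun x y => √3 * R ≤ dist x y) (hc : c ∈ X)
    (hV : volume.real (truncatedVoronoiCell R X c) ≤ 3 * √3 / 2 * R ^ 2) :
    (neighborVectors R X c).Nonempty ∧ ∀ a ∈ neighborVectors R X c, ‖a‖ = √3 * R ∧
      ∀ w : ℂ, ‖w‖ = √3 * R → inner ℝ a w = 3 * R ^ 2 / 2 → w ∈ neighborVectors R X c := by
  have hfin := finite_neighborVectors hR hX c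
  rw [measureReal_def, volume_truncatedVoronoiCell, ← measureReal_def, ← hfin.coe_toFinset] at hV
  have := hexagonal_of_volume_real_truncatedCell_le hR (N := hfin.toFinset)
    (fun a ha => le_norm_of_mem_neighborVectors hX hc (hfin.mem_toFinset.1 ha))
    (fun a ha => (hfin.mem_toFinset.1 ha).2.2)
    (fun a ha b hb hab => le_norm_sub_of_mem_neighborVectors hX (hfin.mem_toFinset.1 ha)
      (hfin.mem_toFinset.1 hb) hab) hV
  simpa only [hfin.toFinset_nonempty, hfin.mem_toFinset] using this

/-- Only points within 2R of `c` define the cell, but `c'` is among them since `z` is within R of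
both. -/
lemma norm_sub_lt_of_mem_truncatedVoronoiCell {c' z : ℂ} (hc' : c' ∈ X) (hne : c ≠ c')
    (hz : z ∈ truncatedVoronoiCell R X c) (hz' : ‖z - c'‖ < R) : ‖z - c‖ < ‖z - c'‖ := by
  have hmem : c' - c ∈ neighborVectors R X c := by
    refine ⟨sub_ne_zero.2 hne.symm, by simpa using hc', ?_⟩
    calc ‖c' - c‖ = ‖(z - c) - (z - c')‖ := by congr 1; ring
      _ ≤ ‖z - c‖ + ‖z - c'‖ := norm_sub_le _ _
      _ < 2 * R := by linarith [hz.1]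
  have h1 := hz.2 _ hmem
  have h2 := norm_sub_sq_real (z - c) (c' - c)
  rw [sub_sub_sub_cancel_right] at h2
  exact lt_of_pow_lt_pow_left₀ 2 (norm_nonneg _) (by linarith)

lemma disjoint_truncatedVoronoiCell {c' : ℂ} (hc : c ∈ X) (hc' : c' ∈ X) (hne : c ≠ c') :
    Disjoint (truncatedVoronoiCell R X c) (truncatedVoronoiCell R X c') := by
  rw [Set.disjoint_left]
  intro z hz hz'
  exact lt_asymm (norm_sub_lt_of_mem_truncatedVoronoiCell hc' hne hz hz'.1)
    (norm_sub_lt_of_mem_truncatedVoronoiCell hc hne.symm hz' hz.1)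

lemma neighborVectors_add {t : ℂ} (ht : ∀ x, x + t ∈ X ↔ x ∈ X) :
    neighborVectors R X (c + t) = neighborVectors R X c := by
  ext a
  rw [neighborVectors, neighborVectors, Set.mem_ofPred_eq, Set.mem_ofPred_eq,
    add_right_comm, ht]

lemma add_mem_truncatedVoronoiCell {t z : ℂ} (ht : ∀ x, x + t ∈ X ↔ x ∈ X)
    (hz : z ∈ truncatedVoronoiCell R X c) : z + t ∈ truncatedVoronoiCell R X (c + t) := by
  rw [truncatedVoronoiCell, Set.mem_preimage, neighborVectors_add ht, add_sub_add_right_eq_sub]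
  exact hz

/-! ### Rotation by 60° and propagation along a neighbor vector -/

/-- The primitive sixth root of unity in the upper half plane. -/
noncomputable def sixthRoot : ℂ := ⟨1 / 2, √3 / 2⟩

lemma sixthRoot_pow_three : sixthRoot ^ 3 = -1 := by
  have h3 : √3 * √3 = 3 := Real.mul_self_sqrt (by norm_num)
  apply Complex.ext
  · simp [sixthRoot, pow_succ]
    linear_combination (-3 / 8) * h3
  · simp [sixthRoot, pow_succ]
    linear_combination (-(√3 / 8)) * h3

lemma norm_mul_sixthRoot (a : ℂ) : ‖a * sixthRoot‖ = ‖a‖ := by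
  have h : ‖sixthRoot‖ ^ 3 = 1 := by rw [← norm_pow, sixthRoot_pow_three]; simp
  rw [norm_mul, (pow_eq_one_iff_of_nonneg (norm_nonneg _) three_ne_zero).1 h, mul_one]

lemma inner_mul_sixthRoot (a : ℂ) : inner ℝ a (a * sixthRoot) = ‖a‖ ^ 2 / 2 := by
  rw [Complex.inner_eq_re_im, Complex.norm_sq_eq_re_im]
  simp [sixthRoot]
  ring

lemma re_mul_im_mul_sixthRoot_sub (a : ℂ) :
    a.re * (a * sixthRoot).im - a.im * (a * sixthRoot).re = √3 / 2 * ‖a‖ ^ 2 := by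
  rw [Complex.norm_sq_eq_re_im]
  simp [sixthRoot]
  ring

lemma mul_sixthRoot_mem_neighborVectors {a : ℂ}
    (hhex : ∀ a ∈ neighborVectors R X c, ‖a‖ = √3 * R ∧
      ∀ w : ℂ, ‖w‖ = √3 * R → inner ℝ a w = 3 * R ^ 2 / 2 → w ∈ neighborVectors R X c)
    (ha : a ∈ neighborVectors R X c) : a * sixthRoot ∈ neighborVectors R X c := by
  obtain ⟨h1, h2⟩ := hhex a ha
  refine h2 _ ((norm_mul_sixthRoot a).trans h1) ?_
  rw [inner_mul_sixthRoot, h1, mul_pow, Real.sq_sqrt (by norm_num)]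

/-- The induction also carries that `a` is a neighbor vector at the current point: the next point
has -a as neighbor vector, and three rotations by 60° turn it into `a`. -/
lemma add_nat_mul_mem_of_hexagonal
    (hhex : ∀ c ∈ X, ∀ a ∈ neighborVectors R X c, ‖a‖ = √3 * R ∧
      ∀ w : ℂ, ‖w‖ = √3 * R → inner ℝ a w = 3 * R ^ 2 / 2 → w ∈ neighborVectors R X c)
    (hc : c ∈ X) {a : ℂ} (ha : a ∈ neighborVectors R X c) (k : ℕ) : c + k * a ∈ X := by
  suffices h : c + k * a ∈ X ∧ a ∈ neighborVectors R X (c + k * a) from h.1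
  induction k with
  | zero => simpa using ⟨hc, ha⟩
  | succ k ih =>
    obtain ⟨h1, h2⟩ := ih
    have h3 : c + k * a + a ∈ X := h2.2.1
    have h4 : -a ∈ neighborVectors R X (c + k * a + a) :=
      ⟨neg_ne_zero.2 h2.1, by simpa using h1, by simpa using h2.2.2⟩
    have h5 := mul_sixthRoot_mem_neighborVectors (hhex _ h3)
      (mul_sixthRoot_mem_neighborVectors (hhex _ h3)
        (mul_sixthRoot_mem_neighborVectors (hhex _ h3) h4))
    have h6 : -a * sixthRoot * sixthRoot * sixthRoot = a := by
      calc -a * sixthRoot * sixthRoot * sixthRoot = -a * sixthRoot ^ 3 := by ring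
        _ = a := by rw [sixthRoot_pow_three]; ring
    rw [h6] at h5
    have h7 : c + ((k + 1 : ℕ) : ℂ) * a = c + k * a + a := by push_cast; ring
    rw [h7]
    exact ⟨h3, h5⟩

end Separated

/-! ### Lifts of a packing and their cells -/

namespace DiskPacking

open SquareTorus

variable {L : ℝ} {n : ℕ}

/-- All lifts of the centers of a packing to the complex plane. -/
def lifts (P : DiskPacking L n) : Set ℂ :=
  {z | proj L (Complex.orthonormalBasisOneI.repr z) ∈ Set.range P.center}

/-- The circumradius of a regular hexagon with incircle of radius `P.radius`. -/
noncomputable def circumradius (P : DiskPacking L n) : ℝ := 2 * P.radius / √3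

lemma circumradius_pos (P : DiskPacking L n) : 0 < P.circumradius := by
  have := P.radius_pos
  unfold circumradius
  positivity

lemma sqrt_three_mul_circumradius (P : DiskPacking L n) :
    √3 * P.circumradius = 2 * P.radius := by
  unfold circumradius
  field_simp

lemma circumradius_sq (P : DiskPacking L n) : P.circumradius ^ 2 = 4 * P.radius ^ 2 / 3 := by
  rw [circumradius, div_pow, Real.sq_sqrt (by norm_num)]
  ring

lemma pairwise_lifts (P : DiskPacking L n) :
    P.lifts.Pairwise fun x y => √3 * P.circumradius ≤ dist x y := by
  intro x hx y hy hxy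
  rw [sqrt_three_mul_circumradius, ← Complex.orthonormalBasisOneI.repr.dist_map]
  exact P.two_mul_radius_le_dist (by simpa using hxy) hx hy

lemma add_mem_lifts_iff (P : DiskPacking L n) {v : Plane} (hv : v ∈ squareLattice L) (x : ℂ) :
    x + Complex.orthonormalBasisOneI.repr.symm v ∈ P.lifts ↔ x ∈ P.lifts := by
  simp only [lifts, Set.mem_ofPred_eq, map_add, LinearIsometryEquiv.apply_symm_apply,
    proj_add_of_mem hv]

lemma exists_lift_center (P : DiskPacking L n) (i : Fin n) :
    ∃ z : ℂ, proj L (Complex.orthonormalBasisOneI.repr z) = P.center i := by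
  obtain ⟨x, hx⟩ := QuotientAddGroup.mk_surjective (P.center i)
  exact ⟨Complex.orthonormalBasisOneI.repr.symm x, by rw [LinearIsometryEquiv.apply_symm_apply]; exact hx⟩

lemma sum_volume_real_truncatedVoronoiCell_le (hL : 0 < L) (P : DiskPacking L n) {z : Fin n → ℂ}
    (hz : ∀ i, proj L (Complex.orthonormalBasisOneI.repr (z i)) = P.center i) :
    ∑ i, volume.real (truncatedVoronoiCell P.circumradius P.lifts (z i)) ≤ L ^ 2 := by
  set e := Complex.orthonormalBasisOneI.repr with he
  have hzX : ∀ i, z i ∈ P.lifts := fun i => ⟨i, (hz i).symm⟩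
  have hzinj : Function.Injective z := fun i j hij =>
    P.center_injective ((hz i).symm.trans ((congrArg (fun w => proj L (e w)) hij).trans (hz j)))
  have hopen := isOpen_truncatedVoronoiCell P.circumradius_pos P.pairwise_lifts
  set S : Set ℂ := ⋃ i, truncatedVoronoiCell P.circumradius P.lifts (z i) with hS
  have hSo : IsOpen S := isOpen_iUnion fun i => hopen _
  have hvolS : volume (e.symm ⁻¹' S) = volume S :=
    e.symm.measurePreserving.measure_preimage hSo.measurableSet.nullMeasurableSet
  have hSo' : IsOpen (e.symm ⁻¹' S) := hSo.preimage e.symm.continuous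
  -- Blichfeldt's principle: a larger area would make two distinct lattice translates of the union
  -- meet, but these consist of cells about distinct lifts.
  have hle : volume (e.symm ⁻¹' S) ≤ volume (fundamentalSquare L) := by
    by_contra! hlt
    obtain ⟨v, w, hvw, hnd⟩ := exists_pair_mem_lattice_not_disjoint_vadd
      (isAddFundamentalDomain_fundamentalSquare hL) hSo'.measurableSet.nullMeasurableSet hlt
    rw [Set.not_disjoint_iff] at hnd
    obtain ⟨p, hpv, hpw⟩ := hnd
    obtain ⟨x, hx, rfl⟩ := Set.mem_vadd_set.1 hpv
    obtain ⟨y, hy, hxy⟩ := Set.mem_vadd_set.1 hpw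
    obtain ⟨i, hi⟩ := Set.mem_iUnion.1 hx
    obtain ⟨j, hj⟩ := Set.mem_iUnion.1 hy
    have hi' := add_mem_truncatedVoronoiCell (P.add_mem_lifts_iff v.2) hi
    have hj' := add_mem_truncatedVoronoiCell (P.add_mem_lifts_iff w.2) hj
    have hxy' : e.symm y + e.symm w = e.symm x + e.symm v := by
      rw [← map_add, ← map_add, add_comm y, add_comm x]
      exact congrArg e.symm hxy
    rw [← he, hxy'] at hj'
    rw [← he] at hi'
    have hne : z i + e.symm v ≠ z j + e.symm w := by
      intro heq
      have hproj : P.center i = P.center j := by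
        have h1 := congrArg (fun u => proj L (e u)) heq
        simp only [map_add, LinearIsometryEquiv.apply_symm_apply, proj_add_of_mem v.2,
          proj_add_of_mem w.2] at h1
        rw [← hz i, ← hz j, h1]
      rw [P.center_injective hproj, add_right_inj] at heq
      exact hvw (Subtype.ext (e.symm.injective heq))
    exact Set.disjoint_left.1 (disjoint_truncatedVoronoiCell
      ((P.add_mem_lifts_iff v.2 _).2 (hzX i)) ((P.add_mem_lifts_iff w.2 _).2 (hzX j)) hne) hi' hj'
  rw [hvolS, volume_fundamentalSquare hL.le] at hle
  have hsum : volume.real S =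
      ∑ i, volume.real (truncatedVoronoiCell P.circumradius P.lifts (z i)) :=
    measureReal_iUnion_fintype
      (fun i j hij => disjoint_truncatedVoronoiCell (hzX i) (hzX j) (hzinj.ne hij))
      (fun i => (hopen _).measurableSet) (fun i => volume_truncatedVoronoiCell_lt_top.ne)
  rw [← hsum]
  exact ENNReal.toReal_le_of_le_ofReal (sq_nonneg L) hle

/-- Pigeonhole: two points of the progression lie over the same one of the finitely many centers. -/
lemma exists_pos_nat_mul_mem_squareLattice (P : DiskPacking L n) {c a : ℂ}
    (h : ∀ k : ℕ, c + k * a ∈ P.lifts) :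
    ∃ m : ℕ, 0 < m ∧ Complex.orthonormalBasisOneI.repr (m * a) ∈ squareLattice L := by
  choose f hf using h
  obtain ⟨k, l, hkl, hfkl⟩ : ∃ k l, k < l ∧ f k = f l := by
    obtain ⟨k, l, hne, h⟩ := Finite.exists_ne_map_eq_of_infinite f
    rcases hne.lt_or_gt with hlt | hlt
    · exact ⟨k, l, hlt, h⟩
    · exact ⟨l, k, hlt, h.symm⟩
  refine ⟨l - k, Nat.sub_pos_of_lt hkl, ?_⟩
  have h1 : proj L (Complex.orthonormalBasisOneI.repr (c + k * a)) =
      proj L (Complex.orthonormalBasisOneI.repr (c + l * a)) := by rw [← hf k, ← hf l, hfkl]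
  have h2 := proj_eq_proj_iff.1 h1
  rw [← map_sub] at h2
  convert h2 using 2
  rw [Nat.cast_sub hkl.le]
  ring

end DiskPacking

/-! ### Incommensurability of the hexagonal and square lattices -/

lemma exists_int_of_repr_mem_squareLattice {L : ℝ} {z : ℂ}
    (hz : Complex.orthonormalBasisOneI.repr z ∈ squareLattice L) :
    ∃ k l : ℤ, z.re = k * L ∧ z.im = l * L := by
  obtain ⟨k, hk⟩ := hz 0
  obtain ⟨l, hl⟩ := hz 1
  rw [Complex.orthonormalBasisOneI_repr_apply] at hk hl
  exact ⟨k, l, by simpa using hk, by simpa using hl⟩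

/-- The determinant of `a` and its rotation is √3/2 · ‖a‖². Up to nonzero rational factors, this
determinant and ‖a‖² would both be integer multiples of L², so eliminating ‖a‖² makes √3 rational.
-/
lemma not_commensurable_hexagonal_square {L : ℝ} (hL : 0 < L) {a : ℂ} (ha : a ≠ 0) {m m' : ℕ}
    (hm : 0 < m) (hm' : 0 < m')
    (h : Complex.orthonormalBasisOneI.repr (m * a) ∈ squareLattice L)
    (h' : Complex.orthonormalBasisOneI.repr (m' * (a * sixthRoot)) ∈ squareLattice L) :
    False := by
  obtain ⟨k, l, hk, hl⟩ := exists_int_of_repr_mem_squareLattice h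
  obtain ⟨k', l', hk', hl'⟩ := exists_int_of_repr_mem_squareLattice h'
  rw [← Complex.ofReal_natCast, Complex.re_ofReal_mul] at hk hk'
  rw [← Complex.ofReal_natCast, Complex.im_ofReal_mul] at hl hl'
  have hdet := re_mul_im_mul_sixthRoot_sub a
  have hnorm := Complex.norm_sq_eq_re_im a
  have hmR : (0 : ℝ) < m := by exact_mod_cast hm
  have hmR' : (0 : ℝ) < m' := by exact_mod_cast hm'
  have e1 : (m : ℝ) ^ 2 * ‖a‖ ^ 2 = (k ^ 2 + l ^ 2) * L ^ 2 := by
    rw [hnorm]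
    linear_combination ((m : ℝ) * a.re + k * L) * hk + ((m : ℝ) * a.im + l * L) * hl
  have e2 : (m : ℝ) * m' * (√3 / 2 * ‖a‖ ^ 2) = (k * l' - l * k') * L ^ 2 := by
    rw [← hdet]
    linear_combination (m' * (a * sixthRoot).im) * hk + k * L * hl' -
      (m' * (a * sixthRoot).re) * hl - l * L * hk'
  have hkl : (0 : ℝ) < k ^ 2 + l ^ 2 := by
    have : 0 < (k ^ 2 + l ^ 2 : ℝ) * L ^ 2 := by
      rw [← e1]
      have := norm_pos_iff.2 ha
      positivity
    exact pos_of_mul_pos_left this (sq_nonneg L)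
  have e3 : √3 * (m' * (k ^ 2 + l ^ 2)) = 2 * m * (k * l' - l * k') := by
    have hL2 : L ^ 2 ≠ 0 := by positivity
    apply mul_right_cancel₀ hL2
    linear_combination (-(√3 * m')) * e1 + 2 * m * e2
  have hirr : Irrational √3 := by
    simpa using Nat.prime_three.irrational_sqrt
  refine hirr ⟨(2 * m * (k * l' - l * k') : ℤ) / (m' * (k ^ 2 + l ^ 2) : ℤ), ?_⟩
  push_cast
  rw [div_eq_iff (by positivity), e3]

theorem mainTheorem1 {L : ℝ} (hL : 0 < L) {n : ℕ} (P : DiskPacking L n) :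
    P.density < Real.pi / Real.sqrt 12 := by
  have h12 : √12 = 2 * √3 := by
    rw [show (12 : ℝ) = 2 ^ 2 * 3 by norm_num, Real.sqrt_mul (by norm_num),
      Real.sqrt_sq (by norm_num)]
  have h3 : √3 * √3 = 3 := Real.mul_self_sqrt (by norm_num)
  suffices h : n * (3 * √3 / 2 * P.circumradius ^ 2) < L ^ 2 by
    refine (P.density_le hL).trans_lt ?_
    rw [P.circumradius_sq] at h
    rw [h12, div_lt_div_iff₀ (by positivity) (by positivity)]
    nlinarith [mul_lt_mul_of_pos_left h Real.pi_pos]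
  choose z hz using P.exists_lift_center
  have hzX : ∀ i, z i ∈ P.lifts := fun i => ⟨i, (hz i).symm⟩
  have hsum := P.sum_volume_real_truncatedVoronoiCell_le hL hz
  have hle : ∀ i ∈ Finset.univ, 3 * √3 / 2 * P.circumradius ^ 2 ≤
      volume.real (truncatedVoronoiCell P.circumradius P.lifts (z i)) := fun i _ =>
    le_volume_real_truncatedVoronoiCell P.circumradius_pos P.pairwise_lifts (hzX i)
  rcases isEmpty_or_nonempty (Fin n) with hn | ⟨⟨i₀⟩⟩
  · have hn0 : n = 0 := by rw [← Fintype.card_fin n, Fintype.card_eq_zero]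
    subst hn0
    simpa using pow_pos hL 2
  by_contra! hcon
  have heq : ∀ i, volume.real (truncatedVoronoiCell P.circumradius P.lifts (z i)) ≤
      3 * √3 / 2 * P.circumradius ^ 2 := by
    by_contra! hc
    obtain ⟨i, hi⟩ := hc
    have := Finset.sum_lt_sum hle ⟨i, Finset.mem_univ i, hi⟩
    rw [Finset.sum_const, Finset.card_univ, Fintype.card_fin, nsmul_eq_mul] at this
    linarith
  have hhex' := fun i => hexagonal_of_volume_real_truncatedVoronoiCell_le P.circumradius_pos
    P.pairwise_lifts (hzX i) (heq i)
  have hhex : ∀ c ∈ P.lifts, ∀ a ∈ neighborVectors P.circumradius P.lifts c,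
      ‖a‖ = √3 * P.circumradius ∧ ∀ w : ℂ, ‖w‖ = √3 * P.circumradius →
        inner ℝ a w = 3 * P.circumradius ^ 2 / 2 →
          w ∈ neighborVectors P.circumradius P.lifts c := by
    -- Every lift is a lattice translate of a chosen `z i` and has the same neighbor vectors.
    rintro c ⟨i, hi⟩
    have hv := SquareTorus.proj_eq_proj_iff.1 ((hz i).trans hi)
    have hc : c = z i + Complex.orthonormalBasisOneI.repr.symm
        (Complex.orthonormalBasisOneI.repr c - Complex.orthonormalBasisOneI.repr (z i)) := by
      simp [map_sub]
    rw [hc, neighborVectors_add (P.add_mem_lifts_iff hv)]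
    exact (hhex' i).2
  obtain ⟨a, ha⟩ := (hhex' i₀).1
  have ha' := mul_sixthRoot_mem_neighborVectors (hhex' i₀).2 ha
  obtain ⟨m, hm, hmL⟩ := P.exists_pos_nat_mul_mem_squareLattice
    (add_nat_mul_mem_of_hexagonal hhex (hzX i₀) ha)
  obtain ⟨m', hm', hmL'⟩ := P.exists_pos_nat_mul_mem_squareLattice
    (add_nat_mul_mem_of_hexagonal hhex (hzX i₀) ha')
  exact not_commensurable_hexagonal_square hL ha.1 hm hm' hmL hmL'
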